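/- **Theorem 3.5 (Buchberger's Algorithm and $K$-category Presentations).** Let $K$ be a field, $\Delta$ a directed graph, $P\Delta$ the free category on $\Delta$ (its arrows are the paths; $uv$ denotes $u$ followed by $v$), and $P_K\Delta$ the free $K$-category on $\Delta$, whose arrows are the polynomials, i.e. the finite $K$-linear combinations of paths with a common source and a common target. Let $R$ be a set of polynomials. Write $f =_R h$ for the congruence generated by $R$: $f$ and $h$ are parallel and $f-h$ is a finite sum $\sum_i k_i p_i r_i q_i$ with $k_i\in K$, $r_i\in R$ (repetitions allowed) and polynomials $p_i,q_i$. Let $>$ be an admissible well-ordering on paths, i.e. a well-ordering of the set of all paths such that $p>q$ implies $upv>uqv$ whenever both composites are defined. For a polynomial $f\neq0$ let $\mathrm{LT}(f)$ be the greatest path occurring in $f$ and $\mathrm{lc}(f)$ its coefficient. For a set $G$ of polynomials, let $f\to_G f-\frac{k}{\mathrm{lc}(r)}\,urv$ whenever $0 \ne r\in G$, $u,v$ are paths, and $u\,\mathrm{LT}(r)\,v$ occurs in $f$ with coefficient $k\ne0$. Let $\stackrel{*}{\to}_G$ be the reflexive transitive closure of $\to_G$. A *match* of nonzero $r_1,r_2\in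 G$ is an equality $u_1\mathrm{LT}(r_1)v_1=u_2\mathrm{LT}(r_2)v_2$ with paths $u_i,v_i$ of one of the forms $u\,\mathrm{LT}(r_1)\,v=\mathrm{LT}(r_2)$, $\mathrm{LT}(r_1)=u\,\mathrm{LT}(r_2)\,v$, $u\,\mathrm{LT}(r_1)=\mathrm{LT}(r_2)\,v$, $\mathrm{LT}(r_1)\,v=u\,\mathrm{LT}(r_2)$, where in the last two forms the two leading terms overlap in a common subpath of positive length. Its *S-polynomial* is $\frac{1}{\mathrm{lc}(r_1)}u_1r_1v_1-\frac{1}{\mathrm{lc}(r_2)}u_2r_2v_2$. *Buchberger's algorithm* applied to $(R,>)$ starts with $G_0=R$. It stops and returns $G_n$ if every S-polynomial $s$ of $G_n$ satisfies $s\stackrel{*}{\to}_{G_n}0$. Otherwise it forms $G_{n+1}$ by adding to $G_n$ a nonempty set of polynomials $ct$, where $c\in K\setminus\{0\}$ and $t$ is obtained by an attempt to reduce an S-polynomial $s$ of $G_n$ that does not lead to zero: $s\stackrel{*}{\to}_{G_n}t$ (possibly $t=s$) and not $t\stackrel{*}{\to}_{G_n}0$. If a run of Buchberger's algorithm on $(R,>)$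 terminates, then its output $G$ is a Gröbner basis for $=_R$ on the arrows of $P_K\Delta$: the relation $\to_G$ is Noetherian and confluent, and its reflexive, symmetric and transitive closure is $=_R$. -/

import Mathlib

open CategoryTheory

namespace KCat

universe u v w

/-- The polynomials `X ⟶ Y` over the graph `V`: the morphisms of the free `K`-category on `V`,
i.e. the finite `K`-linear combinations of paths from `X` to `Y`. -/
abbrev Poly (K : Type w) [Field K] {V : Type u} [Quiver.{v} V] (X Y : Paths V) : Type _ :=
  Free.of K X ⟶ Free.of K Y

/-- All arrows of the free `K`-category on the graph `V`. -/
abbrev Arr (K : Type w) [Field K] (V : Type u) [Quiver.{v} V] : Type _ :=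
  Quiver.Total (Free K (Paths V))

section

variable {K : Type w} [Field K] {V : Type u} [Quiver.{v} V]

/-- A polynomial, seen as an arrow of the free `K`-category. -/
def Poly.toArr {X Y : Paths V} (f : Poly K X Y) : Arr K V :=
  ⟨Free.of K X, Free.of K Y, f⟩

/-- The coefficient of the path `m` in the polynomial `f`. -/
def Poly.coeff {X Y : Paths V} (f : Poly K X Y) (m : X ⟶ Y) : K :=
  (show (X ⟶ Y) →₀ K from f) m

/-- `Poly.ofPath K u` is the path `u` as a polynomial. -/
noncomputable def Poly.ofPath (K : Type w) [Field K] {X Y : Paths V} (u : X ⟶ Y) : Poly K X Y :=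
  (Free.embedding K (Paths V)).map u

/-- `lt` is an admissible well-ordering on the set of all paths of `V` (`lt p q` is `q > p`):
a well-order which is compatible with concatenation.  The paths `u p v` and `u q v` can both be
formed only if `p` and `q` are parallel. -/
structure IsAdmissibleWellOrder
    (lt : Quiver.Total (Paths V) → Quiver.Total (Paths V) → Prop) : Prop where
  isWellOrder : IsWellOrder (Quiver.Total (Paths V)) lt
  comp : ∀ {W X Y Z : Paths V} (u : W ⟶ X) (p q : X ⟶ Y) (v : Y ⟶ Z),
    lt ⟨X, Y, p⟩ ⟨X, Y, q⟩ → lt ⟨W, Z, u ≫ p ≫ v⟩ ⟨W, Z, u ≫ q ≫ v⟩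

/-- The congruence `f =_R h` generated by a set `R` of polynomials: `f - h` is a finite sum
`∑ kᵢ pᵢ rᵢ qᵢ` with `kᵢ ∈ K`, `rᵢ ∈ R` and polynomials `pᵢ`, `qᵢ`. -/
def Cong (R : Set (Arr K V)) {X Y : Paths V} (f h : Poly K X Y) : Prop :=
  f - h ∈ Submodule.span K
    {g : Poly K X Y | ∃ (A B : Paths V) (p : Poly K X A) (r : Poly K A B) (q : Poly K B Y),
      r.toArr ∈ R ∧ g = p ≫ r ≫ q}

variable (lt : Quiver.Total (Paths V) → Quiver.Total (Paths V) → Prop)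

/-- `m` is the leading term of `f`: the greatest path occurring in `f`.
The zero polynomial has no leading term. -/
def IsLeadingTerm {X Y : Paths V} (f : Poly K X Y) (m : X ⟶ Y) : Prop :=
  f.coeff m ≠ 0 ∧ ∀ n : X ⟶ Y, f.coeff n ≠ 0 → n ≠ m → lt ⟨X, Y, n⟩ ⟨X, Y, m⟩

/-- One-step reduction: if `u LT(r) v` occurs in `f` with coefficient `k ≠ 0`, where `r ∈ R`, then
`f → f - (k / c) u r v`, where `c` is the leading coefficient of `r` (so `c = 1` if `r` is monic).
-/
def Reduces (R : Set (Arr K V)) {X Y : Paths V} (f g : Poly K X Y) : Prop :=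
  ∃ (A B : Paths V) (r : Poly K A B) (m : A ⟶ B) (u : X ⟶ A) (v : B ⟶ Y),
    r.toArr ∈ R ∧ IsLeadingTerm lt r m ∧ f.coeff (u ≫ m ≫ v) ≠ 0 ∧
    g = f - (f.coeff (u ≫ m ≫ v) / r.coeff m) • (Poly.ofPath K u ≫ r ≫ Poly.ofPath K v)

/-- Reduction in finitely many (possibly zero) steps. -/
def ReducesStar (R : Set (Arr K V)) {X Y : Paths V} : Poly K X Y → Poly K X Y → Prop :=
  Relation.ReflTransGen (Reduces lt R)

/-- `G` is a Gröbner basis: its reduction relation is Noetherian and confluent. -/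
structure IsGroebnerBasis (G : Set (Arr K V)) : Prop where
  noetherian : ∀ X Y : Paths V, WellFounded fun g f : Poly K X Y => Reduces lt G f g
  confluent : ∀ (X Y : Paths V) (f g h : Poly K X Y),
    ReducesStar lt G f g → ReducesStar lt G f h →
      ∃ k : Poly K X Y, ReducesStar lt G g k ∧ ReducesStar lt G h k

/-- `G` is a Gröbner basis for the congruence `=_R`: it is a Gröbner basis, and the reflexive,
symmetric and transitive closure of its reduction relation is `=_R`. -/
structure IsGroebnerBasisFor (G R : Set (Arr K V)) : Prop extends IsGroebnerBasis lt G where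
  eqvGen_iff : ∀ (X Y : Paths V) (f h : Poly K X Y),
    Relation.EqvGen (Reduces lt G) f h ↔ Cong R f h

/-- `r` divided by the coefficient of its leading term `m`. -/
noncomputable def Poly.monic {X Y : Paths V} (r : Poly K X Y) (m : X ⟶ Y) : Poly K X Y :=
  (r.coeff m)⁻¹ • r

/-- The S-polynomials of `R`.  A match of `r₁, r₂ ∈ R` is an equality
`u₁ LT(r₁) v₁ = u₂ LT(r₂) v₂` in which one leading term contains the other one, or an end of one
leading term is a beginning of the other one (a common subpath `w` of positive length).
Its S-polynomial is `u₁ r₁ v₁ - u₂ r₂ v₂`, formed from the monic multiples of `r₁` and `r₂`. -/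
inductive IsSPoly (R : Set (Arr K V)) : ∀ {X Y : Paths V}, Poly K X Y → Prop
  /-- `u LT(r₁) v = LT(r₂)` -/
  | inside {X Y A B : Paths V} (r₁ : Poly K A B) (r₂ : Poly K X Y) (m₁ : A ⟶ B) (m₂ : X ⟶ Y)
      (u : X ⟶ A) (v : B ⟶ Y) :
      r₁.toArr ∈ R → r₂.toArr ∈ R → IsLeadingTerm lt r₁ m₁ → IsLeadingTerm lt r₂ m₂ →
      u ≫ m₁ ≫ v = m₂ →
      IsSPoly R (Poly.ofPath K u ≫ r₁.monic m₁ ≫ Poly.ofPath K v - r₂.monic m₂)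
  /-- `LT(r₁) = u LT(r₂) v` -/
  | contains {X Y A B : Paths V} (r₁ : Poly K X Y) (r₂ : Poly K A B) (m₁ : X ⟶ Y) (m₂ : A ⟶ B)
      (u : X ⟶ A) (v : B ⟶ Y) :
      r₁.toArr ∈ R → r₂.toArr ∈ R → IsLeadingTerm lt r₁ m₁ → IsLeadingTerm lt r₂ m₂ →
      m₁ = u ≫ m₂ ≫ v →
      IsSPoly R (r₁.monic m₁ - Poly.ofPath K u ≫ r₂.monic m₂ ≫ Poly.ofPath K v)
  /-- `u LT(r₁) = LT(r₂) v`, with `LT(r₂) = u w` and `LT(r₁) = w v` -/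
  | right {X A B Y : Paths V} (r₁ : Poly K A Y) (r₂ : Poly K X B)
      (u : X ⟶ A) (w : A ⟶ B) (v : B ⟶ Y) :
      r₁.toArr ∈ R → r₂.toArr ∈ R →
      IsLeadingTerm lt r₁ (w ≫ v) → IsLeadingTerm lt r₂ (u ≫ w) → 0 < Quiver.Path.length w →
      IsSPoly R (Poly.ofPath K u ≫ r₁.monic (w ≫ v) - r₂.monic (u ≫ w) ≫ Poly.ofPath K v)
  /-- `LT(r₁) v = u LT(r₂)`, with `LT(r₁) = u w` and `LT(r₂) = w v` -/
  | left {X A B Y : Paths V} (r₁ : Poly K X B) (r₂ : Poly K A Y)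
      (u : X ⟶ A) (w : A ⟶ B) (v : B ⟶ Y) :
      r₁.toArr ∈ R → r₂.toArr ∈ R →
      IsLeadingTerm lt r₁ (u ≫ w) → IsLeadingTerm lt r₂ (w ≫ v) → 0 < Quiver.Path.length w →
      IsSPoly R (r₁.monic (u ≫ w) ≫ Poly.ofPath K v - Poly.ofPath K u ≫ r₂.monic (w ≫ v))

/-- The polynomials that Buchberger's algorithm may add to the system `R`: a nonzero multiple of
what an attempt to reduce an S-polynomial `s` of `R` has left (`s` itself, or its remainder), if
that cannot be reduced to zero.  The scalar allows for making the added polynomial monic. -/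
def IsNewPoly (R : Set (Arr K V)) (a : Arr K V) : Prop :=
  ∃ (X Y : Paths V) (s t : Poly K X Y) (c : K),
    IsSPoly lt R s ∧ ReducesStar lt R s t ∧ ¬ ReducesStar lt R t 0 ∧ c ≠ 0 ∧
    a = Poly.toArr (c • t)

/-- One round of Buchberger's algorithm: some new polynomials (one, several, or one for each
S-polynomial that cannot be reduced to zero) are added to the system. -/
def BuchbergerStep (R R' : Set (Arr K V)) : Prop :=
  ∃ T : Set (Arr K V), T.Nonempty ∧ (∀ a ∈ T, IsNewPoly lt R a) ∧ R' = R ∪ T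

/-- The algorithm stops at a system whose S-polynomials can all be reduced to zero. -/
def BuchbergerHalts (R : Set (Arr K V)) : Prop :=
  ∀ (X Y : Paths V) (s : Poly K X Y), IsSPoly lt R s → ReducesStar lt R s 0

/-- Buchberger's algorithm, applied to `(R, >)`, has a run that terminates and returns `G`: finitely
many rounds lead from `R` to `G`, where the algorithm stops. -/
def BuchbergerReturns (R G : Set (Arr K V)) : Prop :=
  Relation.ReflTransGen (BuchbergerStep lt) R G ∧ BuchbergerHalts lt G

end

end KCat

/-! The tool is a filtration of the ideal: `redSpan lt G S` is spanned by the multiples `u r v`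
whose leading path lies in `S`. Taking all paths gives the whole ideal (`redSpan_univ`), which no
round of the algorithm changes, since S-polynomials and their remainders already lie in it.

When every S-polynomial reduces to zero, two monic multiples with the same leading path `p` differ
by a combination of multiples with leading path below `p` (`match_mem_redSpan`). So an ideal element
bounded by `p` either has `p` as a reducible term or can be rewritten strictly below `p`.
Well-founded induction then shows that every nonzero ideal element contains a reducible path
(`exists_isReducible_of_mem_redSpan`).

Reduction terminates for any `G`. Two normal forms that are congruent differ by an ideal element
without reducible paths, hence coincide. This gives confluence and identifies the generated
equivalence with the congruence. -/

namespace KCat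

universe u v w

/-! ### Coefficients, and multiplication of polynomials by paths -/

section Coefficients

variable {K : Type w} [Field K] {V : Type u} [Quiver.{v} V]

namespace Poly

variable {W X Y Z : Paths V}

@[simp] lemma coeff_add (f g : Poly K X Y) (m : X ⟶ Y) :
    (f + g).coeff m = f.coeff m + g.coeff m := rfl

@[simp] lemma coeff_sub (f g : Poly K X Y) (m : X ⟶ Y) :
    (f - g).coeff m = f.coeff m - g.coeff m := rfl

@[simp] lemma coeff_smul (c : K) (f : Poly K X Y) (m : X ⟶ Y) :
    (c • f).coeff m = c * f.coeff m := rfl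

lemma ext_coeff {f g : Poly K X Y} (h : ∀ m, f.coeff m = g.coeff m) : f = g := Finsupp.ext h

lemma exists_coeff_ne_zero {f : Poly K X Y} (h : f ≠ 0) : ∃ m, f.coeff m ≠ 0 := by
  by_contra! H
  exact h (ext_coeff H)

lemma finite_support (f : Poly K X Y) : {m | f.coeff m ≠ 0}.Finite :=
  Finsupp.hasFiniteSupport (show (X ⟶ Y) →₀ K from f)

lemma coeff_ofPath_self (m : X ⟶ Y) : (ofPath K m).coeff m = 1 := Finsupp.single_eq_same

lemma coeff_ofPath_of_ne {m n : X ⟶ Y} (h : n ≠ m) : (ofPath K m).coeff n = 0 :=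
  Finsupp.single_eq_of_ne h

lemma ofPath_comp (u : X ⟶ Y) (v : Y ⟶ Z) : ofPath K (u ≫ v) = ofPath K u ≫ ofPath K v :=
  Functor.map_comp _ _ _

lemma ofPath_id (X : Paths V) : ofPath K (𝟙 X) = 𝟙 _ :=
  CategoryTheory.Functor.map_id _ _

lemma mem_span_ofPath (f : Poly K X Y) :
    f ∈ Submodule.span K (ofPath K '' {m | f.coeff m ≠ 0}) := by
  have h : f = ∑ m ∈ f.finite_support.toFinset, f.coeff m • ofPath K m := by
    have := (Finsupp.sum_single (show (X ⟶ Y) →₀ K from f)).symm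
    refine this.trans ?_
    rw [Finsupp.sum]
    refine Finset.sum_congr (by ext; exact Finsupp.mem_support_iff.trans (by simp [coeff])) fun m _ => ?_
    exact (Finsupp.smul_single_one m (f.coeff m)).symm
  have h' : ∀ S : Submodule K (Poly K X Y),
      (∑ m ∈ f.finite_support.toFinset, f.coeff m • ofPath K m) ∈ S → f ∈ S :=
    fun S hS => h ▸ hS
  refine h' _ (Submodule.sum_mem _ fun m hm => Submodule.smul_mem _ _ (Submodule.subset_span ?_))
  exact ⟨m, by simpa using hm, rfl⟩

/-- Multiplication by a path on either side. -/
noncomputable def whisker (u : W ⟶ X) (v : Y ⟶ Z) : Poly K X Y →ₗ[K] Poly K W Z :=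
  Linear.leftComp K _ (ofPath K u) ∘ₗ Linear.rightComp K _ (ofPath K v)

lemma whisker_apply (u : W ⟶ X) (v : Y ⟶ Z) (f : Poly K X Y) :
    whisker u v f = ofPath K u ≫ f ≫ ofPath K v := rfl

lemma whisker_ofPath (u : W ⟶ X) (v : Y ⟶ Z) (m : X ⟶ Y) :
    whisker u v (ofPath K m) = ofPath K (u ≫ m ≫ v) := by
  simp only [whisker_apply, ofPath_comp]

lemma whisker_whisker {W' Z' : Paths V} (u' : W' ⟶ W) (v' : Z ⟶ Z') (u : W ⟶ X) (v : Y ⟶ Z)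
    (f : Poly K X Y) : whisker u' v' (whisker u v f) = whisker (u' ≫ u) (v ≫ v') f := by
  simp [whisker_apply, ofPath_comp]

lemma whisker_injective (u : W ⟶ X) (v : Y ⟶ Z) :
    Function.Injective fun m : X ⟶ Y => u ≫ m ≫ v := fun _ _ h =>
  Quiver.Path.comp_injective_left v (Quiver.Path.comp_injective_right u h)

/-- Both sides are linear and agree on single paths. Since paths cancel on both sides, the
relabelling is injective and no coefficients merge. -/
lemma whisker_eq_mapDomain (u : W ⟶ X) (v : Y ⟶ Z) (f : Poly K X Y) :
    whisker u v f = Finsupp.mapDomain (fun m : X ⟶ Y => u ≫ m ≫ v)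
      (show (X ⟶ Y) →₀ K from f) := by
  have h : whisker u v = (Finsupp.lmapDomain K K fun m : X ⟶ Y => u ≫ m ≫ v :
      ((X ⟶ Y) →₀ K) →ₗ[K] ((W ⟶ Z) →₀ K)) := by
    refine Finsupp.lhom_ext' fun m => LinearMap.ext_ring ?_
    refine (whisker_ofPath u v m).trans ?_
    exact (Finsupp.mapDomain_single (f := fun m : X ⟶ Y => u ≫ m ≫ v) (a := m) (b := (1 : K))).symm
  exact DFunLike.congr_fun h f

@[simp] lemma coeff_whisker (u : W ⟶ X) (v : Y ⟶ Z) (f : Poly K X Y) (m : X ⟶ Y) :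
    (whisker u v f).coeff (u ≫ m ≫ v) = f.coeff m := by
  rw [whisker_eq_mapDomain]
  exact Finsupp.mapDomain_apply (whisker_injective u v) _ _

lemma exists_of_coeff_whisker_ne_zero {u : W ⟶ X} {v : Y ⟶ Z} {f : Poly K X Y} {n : W ⟶ Z}
    (h : (whisker u v f).coeff n ≠ 0) : ∃ m, f.coeff m ≠ 0 ∧ n = u ≫ m ≫ v := by
  by_contra! H
  apply h
  rw [whisker_eq_mapDomain]
  by_cases hn : n ∈ Set.range fun m : X ⟶ Y => u ≫ m ≫ v
  · obtain ⟨m, rfl⟩ := hn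
    by_contra h0
    refine H m (fun hm => h0 ?_) rfl
    exact (Finsupp.mapDomain_apply (whisker_injective u v) _ _).trans hm
  · exact Finsupp.mapDomain_of_notMem_range _ _ hn

end Poly

end Coefficients

/-! ### Two factorisations of one path -/

section Paths

variable {V : Type u} [Quiver.{v} V]

/-- Levi's lemma for paths: strip common last edges until one right factor is empty. -/
lemma path_split_aux {W X Y : V} (a : Quiver.Path W X) (c : Quiver.Path W Y) {Z : V}
    (b : Quiver.Path X Z) (d : Quiver.Path Y Z) (h : a.comp b = c.comp d) :
    (∃ e : Quiver.Path X Y, c = a.comp e ∧ b = e.comp d) ∨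
      ∃ e : Quiver.Path Y X, a = c.comp e ∧ d = e.comp b := by
  induction b with
  | nil => exact Or.inr ⟨d, h, rfl⟩
  | cons b x ih =>
    cases d with
    | nil => exact Or.inl ⟨b.cons x, h.symm, rfl⟩
    | cons d y =>
      simp only [Quiver.Path.comp_cons] at h
      obtain rfl := Quiver.Path.obj_eq_of_cons_eq_cons h
      obtain rfl := eq_of_heq (Quiver.Path.hom_heq_of_cons_eq_cons h)
      rcases ih d (eq_of_heq (Quiver.Path.heq_of_cons_eq_cons h)) with ⟨e, rfl, rfl⟩ | ⟨e, rfl, rfl⟩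
      · exact Or.inl ⟨e, rfl, rfl⟩
      · exact Or.inr ⟨e, rfl, rfl⟩

lemma path_split {W X Y Z : Paths V} {a : W ⟶ X} {b : X ⟶ Z} {c : W ⟶ Y} {d : Y ⟶ Z}
    (h : a ≫ b = c ≫ d) :
    (∃ e : X ⟶ Y, c = a ≫ e ∧ b = e ≫ d) ∨ ∃ e : Y ⟶ X, a = c ≫ e ∧ d = e ≫ b :=
  path_split_aux a c b d h

end Paths

/-! ### Leading terms under an admissible order -/

section LeadingTerms

variable {K : Type w} [Field K] {V : Type u} [Quiver.{v} V]
  {lt : Quiver.Total (Paths V) → Quiver.Total (Paths V) → Prop} {W X Y Z : Paths V}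

lemma IsAdmissibleWellOrder.trans (hlt : IsAdmissibleWellOrder lt) {a b c : Quiver.Total (Paths V)}
    (hab : lt a b) (hbc : lt b c) : lt a c :=
  have := hlt.isWellOrder
  _root_.trans_of lt hab hbc

lemma IsAdmissibleWellOrder.irrefl (hlt : IsAdmissibleWellOrder lt) (a : Quiver.Total (Paths V)) :
    ¬ lt a a :=
  have := hlt.isWellOrder
  _root_.irrefl_of lt a

lemma IsAdmissibleWellOrder.trichotomous (hlt : IsAdmissibleWellOrder lt) (p q : X ⟶ Y) :
    lt ⟨X, Y, p⟩ ⟨X, Y, q⟩ ∨ p = q ∨ lt ⟨X, Y, q⟩ ⟨X, Y, p⟩ := by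
  have := hlt.isWellOrder
  rcases _root_.trichotomous_of lt ⟨X, Y, p⟩ ⟨X, Y, q⟩ with h | h | h
  · exact Or.inl h
  · simp at h
    exact Or.inr (Or.inl h)
  · exact Or.inr (Or.inr h)

lemma IsAdmissibleWellOrder.wf (hlt : IsAdmissibleWellOrder lt) (X Y : Paths V) :
    WellFounded fun p q : X ⟶ Y => lt ⟨X, Y, p⟩ ⟨X, Y, q⟩ :=
  have := hlt.isWellOrder
  InvImage.wf (fun p : X ⟶ Y => (⟨X, Y, p⟩ : Quiver.Total (Paths V)))
    (IsWellFounded.wf (r := lt))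

lemma exists_isLeadingTerm (hlt : IsAdmissibleWellOrder lt) {f : Poly K X Y} (hf : f ≠ 0) :
    ∃ m, IsLeadingTerm lt f m := by
  have key : ∀ s : Finset (X ⟶ Y), s.Nonempty →
      ∃ m ∈ s, ∀ n ∈ s, n ≠ m → lt ⟨X, Y, n⟩ ⟨X, Y, m⟩ := by
    intro s hs
    induction hs using Finset.Nonempty.cons_induction with
    | singleton a => exact ⟨a, by simp, by simp⟩
    | cons a s ha _ ih =>
      obtain ⟨m, hm, hmax⟩ := ih
      rcases hlt.trichotomous a m with h | rfl | h
      · refine ⟨m, by simp [hm], fun n hn hnm => ?_⟩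
        rcases Finset.mem_cons.1 hn with rfl | hn
        · exact h
        · exact hmax n hn hnm
      · exact absurd hm ha
      · refine ⟨a, by simp, fun n hn hna => ?_⟩
        rcases Finset.mem_cons.1 hn with rfl | hn
        · exact absurd rfl hna
        · by_cases hnm : n = m
          · exact hnm ▸ h
          · exact hlt.trans (hmax n hn hnm) h
  obtain ⟨n, hn⟩ := Poly.exists_coeff_ne_zero hf
  obtain ⟨m, hm, hmax⟩ := key f.finite_support.toFinset ⟨n, by simpa using hn⟩
  exact ⟨m, by simpa using hm, fun k hk => hmax k (by simpa using hk)⟩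

lemma IsLeadingTerm.whisker (hlt : IsAdmissibleWellOrder lt) {f : Poly K X Y} {m : X ⟶ Y}
    (h : IsLeadingTerm lt f m) (u : W ⟶ X) (v : Y ⟶ Z) :
    IsLeadingTerm lt (Poly.whisker u v f) (u ≫ m ≫ v) := by
  refine ⟨by simpa using h.1, fun n hn hnm => ?_⟩
  obtain ⟨m', hm', rfl⟩ := Poly.exists_of_coeff_whisker_ne_zero hn
  exact hlt.comp u m' m v (h.2 m' hm' fun h => hnm (h ▸ rfl))

lemma IsLeadingTerm.coeff_monic {f : Poly K X Y} {m : X ⟶ Y} (h : IsLeadingTerm lt f m) :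
    (f.monic m).coeff m = 1 :=
  inv_mul_cancel₀ h.1

lemma IsLeadingTerm.monic {f : Poly K X Y} {m : X ⟶ Y} (h : IsLeadingTerm lt f m) :
    IsLeadingTerm lt (f.monic m) m := by
  refine ⟨by simp [h.coeff_monic], fun n hn => h.2 n fun h0 => hn ?_⟩
  simp [Poly.monic, h0]

lemma IsLeadingTerm.lt_of_coeff_sub_ne_zero {f g : Poly K X Y} {m : X ⟶ Y}
    (hf : IsLeadingTerm lt f m) (hg : IsLeadingTerm lt g m) (hfg : f.coeff m = g.coeff m)
    {n : X ⟶ Y} (hn : (f - g).coeff n ≠ 0) : lt ⟨X, Y, n⟩ ⟨X, Y, m⟩ := by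
  have hnm : n ≠ m := by
    rintro rfl
    exact hn (by simp [hfg])
  by_cases h : f.coeff n = 0
  · refine hg.2 n (fun h' => hn ?_) hnm
    simp [h, h']
  · exact hf.2 n h hnm

lemma isLeadingTerm_ofPath (m : X ⟶ Y) : IsLeadingTerm lt (Poly.ofPath K m) m :=
  ⟨by simp [Poly.coeff_ofPath_self], fun _ hn hnm => absurd (Poly.coeff_ofPath_of_ne hnm) hn⟩

end LeadingTerms

/-! ### Spans filtered by leading path, and termination of reduction -/

section RedSpan

variable {K : Type w} [Field K] {V : Type u} [Quiver.{v} V]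
  {lt : Quiver.Total (Paths V) → Quiver.Total (Paths V) → Prop} {G : Set (Arr K V)}
  {W X Y Z : Paths V}

/-- The span of the polynomials `u r v` with `r ∈ G` and `u LT(r) v ∈ S`. -/
noncomputable def redSpan (lt : Quiver.Total (Paths V) → Quiver.Total (Paths V) → Prop)
    (G : Set (Arr K V)) (S : Set (X ⟶ Y)) : Submodule K (Poly K X Y) :=
  Submodule.span K {g | ∃ (A B : Paths V) (r : Poly K A B) (m : A ⟶ B) (u : X ⟶ A) (v : B ⟶ Y),
    r.toArr ∈ G ∧ IsLeadingTerm lt r m ∧ u ≫ m ≫ v ∈ S ∧ g = Poly.whisker u v r}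

/-- The paths parallel to `p` and smaller than `p`. -/
def pathsBelow (lt : Quiver.Total (Paths V) → Quiver.Total (Paths V) → Prop) (p : X ⟶ Y) :
    Set (X ⟶ Y) :=
  {n | lt ⟨X, Y, n⟩ ⟨X, Y, p⟩}

lemma whisker_mem_redSpan {A B : Paths V} {r : Poly K A B} {m : A ⟶ B} {S : Set (X ⟶ Y)}
    (hr : r.toArr ∈ G) (hm : IsLeadingTerm lt r m) {u : X ⟶ A} {v : B ⟶ Y}
    (hS : u ≫ m ≫ v ∈ S) : Poly.whisker u v r ∈ redSpan lt G S :=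
  Submodule.subset_span ⟨A, B, r, m, u, v, hr, hm, hS, rfl⟩

lemma redSpan_mono {S T : Set (X ⟶ Y)} (h : S ⊆ T) : redSpan lt G S ≤ redSpan lt G T := by
  refine Submodule.span_mono ?_
  rintro _ ⟨A, B, r, m, u, v, hr, hm, hS, rfl⟩
  exact ⟨A, B, r, m, u, v, hr, hm, h hS, rfl⟩

lemma whisker_mem_redSpan_of_mem {S : Set (X ⟶ Y)} {T : Set (W ⟶ Z)} {u : W ⟶ X} {v : Y ⟶ Z}
    (h : ∀ n ∈ S, u ≫ n ≫ v ∈ T) {f : Poly K X Y} (hf : f ∈ redSpan lt G S) :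
    Poly.whisker u v f ∈ redSpan lt G T := by
  revert f
  change redSpan lt G S ≤ (redSpan lt G T).comap (Poly.whisker u v)
  refine Submodule.span_le.2 ?_
  rintro _ ⟨A, B, r, m, u', v', hr, hm, hS, rfl⟩
  rw [SetLike.mem_coe, Submodule.mem_comap, Poly.whisker_whisker]
  refine whisker_mem_redSpan hr hm ?_
  simpa using h _ hS

lemma whisker_mem_redSpan_pathsBelow (hlt : IsAdmissibleWellOrder lt) {p : X ⟶ Y} (u : W ⟶ X)
    (v : Y ⟶ Z) {f : Poly K X Y} (hf : f ∈ redSpan lt G (pathsBelow lt p)) :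
    Poly.whisker u v f ∈ redSpan lt G (pathsBelow lt (u ≫ p ≫ v)) :=
  whisker_mem_redSpan_of_mem (fun n hn => hlt.comp u n p v hn) hf

lemma comp_right_mem_redSpan {B C : Paths V} {r : Poly K X B} {m : X ⟶ B} {S : Set (X ⟶ C)}
    (hr : r.toArr ∈ G) (hm : IsLeadingTerm lt r m) {q : Poly K B C}
    (hq : ∀ n, q.coeff n ≠ 0 → m ≫ n ∈ S) : r ≫ q ∈ redSpan lt G S := by
  have : Submodule.span K (Poly.ofPath K '' {n | q.coeff n ≠ 0}) ≤
      (redSpan lt G S).comap (Linear.leftComp K _ r) := by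
    refine Submodule.span_le.2 ?_
    rintro _ ⟨n, hn, rfl⟩
    have := whisker_mem_redSpan (u := 𝟙 X) (v := n) (S := S) hr hm (by simpa using hq n hn)
    simpa [Poly.whisker_apply, Poly.ofPath_id] using this
  exact this q.mem_span_ofPath

lemma comp_left_mem_redSpan {A B : Paths V} {r : Poly K B Y} {m : B ⟶ Y} {S : Set (A ⟶ Y)}
    (hr : r.toArr ∈ G) (hm : IsLeadingTerm lt r m) {q : Poly K A B}
    (hq : ∀ n, q.coeff n ≠ 0 → n ≫ m ∈ S) : q ≫ r ∈ redSpan lt G S := by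
  have : Submodule.span K (Poly.ofPath K '' {n | q.coeff n ≠ 0}) ≤
      (redSpan lt G S).comap (Linear.rightComp K _ r) := by
    refine Submodule.span_le.2 ?_
    rintro _ ⟨n, hn, rfl⟩
    have := whisker_mem_redSpan (u := n) (v := 𝟙 Y) (S := S) hr hm (by simpa using hq n hn)
    simpa [Poly.whisker_apply, Poly.ofPath_id] using this
  exact this q.mem_span_ofPath

lemma lt_of_mem_redSpan_pathsBelow (hlt : IsAdmissibleWellOrder lt) {p : X ⟶ Y} {f : Poly K X Y}
    (hf : f ∈ redSpan lt G (pathsBelow lt p)) {n : X ⟶ Y} (hn : f.coeff n ≠ 0) :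
    lt ⟨X, Y, n⟩ ⟨X, Y, p⟩ := by
  contrapose! hn
  induction hf using Submodule.span_induction with
  | mem g hg =>
    obtain ⟨A, B, r, m, u, v, -, hm, hS, rfl⟩ := hg
    by_contra h0
    by_cases h : n = u ≫ m ≫ v
    · exact hn (h ▸ hS)
    · exact hn (hlt.trans ((hm.whisker hlt u v).2 n h0 h) hS)
  | zero => rfl
  | add f g _ _ hf hg => simp [hf, hg]
  | smul c f _ hf => simp [hf]

/-- Isolates what later arguments need from a step: it erases one path `p`, alters otherwise only
smaller paths, and subtracts a multiple with leading path `p`. -/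
lemma Reduces.spec (hlt : IsAdmissibleWellOrder lt) {f g : Poly K X Y} (h : Reduces lt G f g) :
    ∃ p, f.coeff p ≠ 0 ∧ g.coeff p = 0 ∧
      (∀ n, f.coeff n = g.coeff n ∨ n = p ∨ lt ⟨X, Y, n⟩ ⟨X, Y, p⟩) ∧
      ∀ S : Set (X ⟶ Y), p ∈ S → f - g ∈ redSpan lt G S := by
  obtain ⟨A, B, r, m, u, v, hr, hm, hf, rfl⟩ := h
  rw [← Poly.whisker_apply]
  refine ⟨u ≫ m ≫ v, hf, ?_, fun n => ?_, fun S hS => ?_⟩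
  · simp [div_mul_cancel₀ _ hm.1]
  · by_cases hn : n = u ≫ m ≫ v
    · exact Or.inr (Or.inl hn)
    by_cases h : (Poly.whisker u v r).coeff n = 0
    · left
      simp [h]
    · exact Or.inr (Or.inr ((hm.whisker hlt u v).2 n h hn))
  · rw [sub_sub_cancel]
    exact Submodule.smul_mem _ _ (whisker_mem_redSpan hr hm hS)

lemma ReducesStar.sub_mem_redSpan (hlt : IsAdmissibleWellOrder lt) {f g : Poly K X Y}
    (h : ReducesStar lt G f g) : f - g ∈ redSpan lt G Set.univ := by
  induction h with
  | refl => simp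
  | tail _ h ih =>
    obtain ⟨p, -, -, -, hp⟩ := h.spec hlt
    simpa using add_mem ih (hp Set.univ trivial)

/-- Reduction never creates paths larger than the one it erases, so the bound `p` survives every
step and each subtracted multiple has its leading path below `p`. -/
lemma mem_redSpan_pathsBelow_of_reducesStar_zero (hlt : IsAdmissibleWellOrder lt) {p : X ⟶ Y}
    {f : Poly K X Y} (h : ReducesStar lt G f 0)
    (hf : ∀ n, f.coeff n ≠ 0 → lt ⟨X, Y, n⟩ ⟨X, Y, p⟩) : f ∈ redSpan lt G (pathsBelow lt p) := by
  induction h using Relation.ReflTransGen.head_induction_on with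
  | refl => exact zero_mem _
  | @head f g hfg _ ih =>
    obtain ⟨q, hq, -, hcoeff, hspan⟩ := hfg.spec hlt
    have hg : g ∈ redSpan lt G (pathsBelow lt p) := by
      refine ih fun n hn => ?_
      rcases hcoeff n with h | rfl | h
      · exact hf n (h ▸ hn)
      · exact hf _ hq
      · exact hlt.trans h (hf q hq)
    simpa using add_mem (hspan (pathsBelow lt p) (hf q hq)) hg

lemma wellFounded_reduces (hlt : IsAdmissibleWellOrder lt) (G : Set (Arr K V)) (X Y : Paths V) :
    WellFounded fun g f : Poly K X Y => Reduces lt G f g := by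
  have : Std.Trichotomous fun p q : X ⟶ Y => lt ⟨X, Y, q⟩ ⟨X, Y, p⟩ := by
    refine ⟨fun p q h₁ h₂ => ?_⟩
    rcases hlt.trichotomous p q with h | h | h
    exacts [absurd h h₂, h, absurd h h₁]
  -- `K` carries no order, but none is needed: a step turns a nonzero coefficient into zero and
  -- keeps all coefficients at larger paths, which is a descent in the lexicographic order comparing
  -- larger paths first.
  have hwf : WellFounded fun a b : K => a = 0 ∧ b ≠ 0 := by
    have h0 : Acc (fun a b : K => a = 0 ∧ b ≠ 0) 0 := ⟨_, fun _ h => absurd rfl h.2⟩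
    exact ⟨fun b => ⟨_, fun a h => h.1 ▸ h0⟩⟩
  have := Finsupp.Lex.wellFounded' (r := fun p q : X ⟶ Y => lt ⟨X, Y, q⟩ ⟨X, Y, p⟩)
    (s := fun a b : K => a = 0 ∧ b ≠ 0) (fun _ h => h.2 rfl) hwf (hlt.wf X Y)
  refine Subrelation.wf (fun {g f} h => ?_) this
  obtain ⟨p, hf, hg, hcoeff, -⟩ := Reduces.spec hlt h
  refine ⟨p, fun n hn => ?_, hg, hf⟩
  rcases hcoeff n with h | rfl | h
  · exact h.symm
  · exact absurd hn (hlt.irrefl _)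
  · exact absurd (hlt.trans h hn) (hlt.irrefl _)

end RedSpan

/-! ### Multiples with a common leading path -/

section Matches

variable {K : Type w} [Field K] {V : Type u} [Quiver.{v} V]
  {lt : Quiver.Total (Paths V) → Quiver.Total (Paths V) → Prop} {G : Set (Arr K V)}
  {X Y : Paths V}

/-- The cofactor difference of two elements of `G` whose leading terms do not overlap in a path
is a combination of smaller multiples of these elements. -/
lemma disjoint_mem_redSpan (hlt : IsAdmissibleWellOrder lt) {A₁ B₁ A₂ B₂ : Paths V}
    {r₁ : Poly K A₁ B₁} {r₂ : Poly K A₂ B₂} {m₁ : A₁ ⟶ B₁} {m₂ : A₂ ⟶ B₂}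
    (hr₁ : r₁.toArr ∈ G) (hr₂ : r₂.toArr ∈ G) (hm₁ : IsLeadingTerm lt r₁ m₁)
    (hm₂ : IsLeadingTerm lt r₂ m₂) (w : B₁ ⟶ A₂) :
    Poly.whisker (𝟙 A₁) (w ≫ m₂) (r₁.monic m₁) - Poly.whisker (m₁ ≫ w) (𝟙 B₂) (r₂.monic m₂) ∈
      redSpan lt G (pathsBelow lt (m₁ ≫ w ≫ m₂)) := by
  have h₁ : r₁ ≫ Poly.whisker w (𝟙 B₂) (r₂.monic m₂ - Poly.ofPath K m₂) ∈
      redSpan lt G (pathsBelow lt (m₁ ≫ w ≫ m₂)) := by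
    refine comp_right_mem_redSpan hr₁ hm₁ fun n hn => ?_
    obtain ⟨k, hk, rfl⟩ := Poly.exists_of_coeff_whisker_ne_zero hn
    have := hlt.comp (m₁ ≫ w) _ _ (𝟙 B₂) (hm₂.monic.lt_of_coeff_sub_ne_zero
      (isLeadingTerm_ofPath m₂) (by rw [hm₂.coeff_monic, Poly.coeff_ofPath_self]) hk)
    simpa [pathsBelow] using this
  have h₂ : Poly.whisker (𝟙 A₁) w (r₁.monic m₁ - Poly.ofPath K m₁) ≫ r₂ ∈
      redSpan lt G (pathsBelow lt (m₁ ≫ w ≫ m₂)) := by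
    refine comp_left_mem_redSpan hr₂ hm₂ fun n hn => ?_
    obtain ⟨k, hk, rfl⟩ := Poly.exists_of_coeff_whisker_ne_zero hn
    have := hlt.comp (𝟙 A₁) _ _ (w ≫ m₂) (hm₁.monic.lt_of_coeff_sub_ne_zero
      (isLeadingTerm_ofPath m₁) (by rw [hm₁.coeff_monic, Poly.coeff_ofPath_self]) hk)
    simpa [pathsBelow] using this
  -- For monic `r₁`, `r₂` the identity is `r₁ w m₂ - m₁ w r₂ = (r₁ - m₁) w r₂ - r₁ w (r₂ - m₂)`;
  -- passing to monic multiples accounts for the inverse scalars.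
  have := sub_mem (Submodule.smul_mem _ (r₂.coeff m₂)⁻¹ h₂)
    (Submodule.smul_mem _ (r₁.coeff m₁)⁻¹ h₁)
  convert this using 1
  rw [← Linear.comp_smul, ← Linear.smul_comp]
  change _ = _ ≫ r₂.monic m₂ - r₁.monic m₁ ≫ _
  simp [Poly.whisker_apply, Poly.ofPath_id, Poly.ofPath_comp]

lemma IsSPoly.mem_redSpan_pathsBelow (hlt : IsAdmissibleWellOrder lt)
    (hG : BuchbergerHalts lt G) {f g : Poly K X Y} {p : X ⟶ Y} (hs : IsSPoly lt G (f - g))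
    (hf : IsLeadingTerm lt f p) (hg : IsLeadingTerm lt g p) (hfg : f.coeff p = g.coeff p) :
    f - g ∈ redSpan lt G (pathsBelow lt p) :=
  mem_redSpan_pathsBelow_of_reducesStar_zero hlt (hG _ _ _ hs) fun _ hn =>
    hf.lt_of_coeff_sub_ne_zero hg hfg hn

/-- With `m₁` starting first, `m₂` lies beyond it, inside it, or overlaps its end. The first case
needs no S-polynomial; the others use `contains` and `left`. The remaining two match forms arise by
exchanging the polynomials. -/
lemma match_mem_redSpan_of_prefix (hlt : IsAdmissibleWellOrder lt) (hG : BuchbergerHalts lt G)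
    {A₁ B₁ A₂ B₂ : Paths V} {r₁ : Poly K A₁ B₁} {r₂ : Poly K A₂ B₂} {m₁ : A₁ ⟶ B₁} {m₂ : A₂ ⟶ B₂}
    (hr₁ : r₁.toArr ∈ G) (hr₂ : r₂.toArr ∈ G) (hm₁ : IsLeadingTerm lt r₁ m₁)
    (hm₂ : IsLeadingTerm lt r₂ m₂) {w : A₁ ⟶ A₂} {v₁ : B₁ ⟶ Y} {v₂ : B₂ ⟶ Y}
    (h : m₁ ≫ v₁ = w ≫ m₂ ≫ v₂) :
    Poly.whisker (𝟙 A₁) v₁ (r₁.monic m₁) - Poly.whisker w v₂ (r₂.monic m₂) ∈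
      redSpan lt G (pathsBelow lt (m₁ ≫ v₁)) := by
  rcases path_split h with ⟨e, rfl, rfl⟩ | ⟨e, rfl, h'⟩
  · have := whisker_mem_redSpan_pathsBelow hlt (𝟙 A₁) v₂
      (disjoint_mem_redSpan hlt hr₁ hr₂ hm₁ hm₂ e)
    simpa [Poly.whisker_whisker] using this
  clear h
  rcases path_split h' with ⟨x, rfl, rfl⟩ | ⟨x, rfl, rfl⟩
  · have hs := IsSPoly.contains (lt := lt) (R := G) r₁ r₂ _ m₂ w x hr₁ hr₂ hm₁ hm₂ rfl
    rw [← Poly.whisker_apply] at hs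
    have := whisker_mem_redSpan_pathsBelow hlt (𝟙 A₁) v₁
      (hs.mem_redSpan_pathsBelow hlt hG hm₁.monic (hm₂.monic.whisker hlt w x)
        (by rw [Poly.coeff_whisker, hm₁.coeff_monic, hm₂.coeff_monic]))
    simpa [Poly.whisker_whisker] using this
  · rcases Nat.eq_zero_or_pos (Quiver.Path.length e) with he | he
    -- An empty overlap is not a match; the leading terms are adjacent, the disjoint case with an
    -- identity path between them.
    · obtain rfl := Quiver.Path.eq_of_length_zero e he
      obtain rfl : e = 𝟙 _ := Quiver.Path.eq_nil_of_length_zero e he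
      have := whisker_mem_redSpan_pathsBelow hlt (𝟙 A₁) v₂
        (disjoint_mem_redSpan hlt hr₁ hr₂ hm₁ hm₂ (𝟙 _))
      simpa [Poly.whisker_whisker] using this
    · have hs := IsSPoly.left (lt := lt) (R := G) r₁ r₂ w e x hr₁ hr₂ hm₁ hm₂ he
      have e₁ : r₁.monic (w ≫ e) ≫ Poly.ofPath K x =
          Poly.whisker (𝟙 _) x (r₁.monic (w ≫ e)) := by
        simp [Poly.whisker_apply, Poly.ofPath_id]
      have e₂ : Poly.ofPath K w ≫ r₂.monic (e ≫ x) =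
          Poly.whisker w (𝟙 _) (r₂.monic (e ≫ x)) := by
        simp [Poly.whisker_apply, Poly.ofPath_id]
      rw [e₁, e₂] at hs
      have h₁ := hm₁.monic.whisker hlt (𝟙 _) x
      have h₂ := hm₂.monic.whisker hlt w (𝟙 _)
      have h₃ := Poly.coeff_whisker (𝟙 _) x (r₁.monic (w ≫ e)) (w ≫ e)
      have h₄ := Poly.coeff_whisker w (𝟙 _) (r₂.monic (e ≫ x)) (e ≫ x)
      rw [hm₁.coeff_monic] at h₃
      rw [hm₂.coeff_monic] at h₄
      simp only [Category.id_comp, Category.comp_id, Category.assoc] at h₁ h₂ h₃ h₄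
      have := whisker_mem_redSpan_pathsBelow hlt (𝟙 A₁) v₂
        (hs.mem_redSpan_pathsBelow hlt hG h₁ h₂ (h₃.trans h₄.symm))
      simpa [Poly.whisker_whisker] using this

lemma match_mem_redSpan (hlt : IsAdmissibleWellOrder lt) (hG : BuchbergerHalts lt G)
    {A₁ B₁ A₂ B₂ : Paths V} {r₁ : Poly K A₁ B₁} {r₂ : Poly K A₂ B₂} {m₁ : A₁ ⟶ B₁} {m₂ : A₂ ⟶ B₂}
    (hr₁ : r₁.toArr ∈ G) (hr₂ : r₂.toArr ∈ G) (hm₁ : IsLeadingTerm lt r₁ m₁)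
    (hm₂ : IsLeadingTerm lt r₂ m₂) {u₁ : X ⟶ A₁} {v₁ : B₁ ⟶ Y} {u₂ : X ⟶ A₂} {v₂ : B₂ ⟶ Y}
    (h : u₁ ≫ m₁ ≫ v₁ = u₂ ≫ m₂ ≫ v₂) :
    Poly.whisker u₁ v₁ (r₁.monic m₁) - Poly.whisker u₂ v₂ (r₂.monic m₂) ∈
      redSpan lt G (pathsBelow lt (u₁ ≫ m₁ ≫ v₁)) := by
  rcases path_split h with ⟨w, rfl, h'⟩ | ⟨w, rfl, h'⟩
  · have := whisker_mem_redSpan_pathsBelow hlt u₁ (𝟙 Y)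
      (match_mem_redSpan_of_prefix hlt hG hr₁ hr₂ hm₁ hm₂ h')
    simpa [Poly.whisker_whisker] using this
  · rw [h, ← neg_mem_iff, neg_sub]
    have := whisker_mem_redSpan_pathsBelow hlt u₂ (𝟙 Y)
      (match_mem_redSpan_of_prefix hlt hG hr₂ hr₁ hm₂ hm₁ h')
    simpa [Poly.whisker_whisker] using this

end Matches

/-! ### Reducible paths in ideal elements, and confluence -/

section Confluence

variable {K : Type w} [Field K] {V : Type u} [Quiver.{v} V]
  {lt : Quiver.Total (Paths V) → Quiver.Total (Paths V) → Prop} {G : Set (Arr K V)}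
  {X Y : Paths V}

/-- A combination uses finitely many generators, so one of their leading paths is largest. -/
lemma exists_bound_of_mem_redSpan (hlt : IsAdmissibleWellOrder lt) {S : Set (X ⟶ Y)}
    {f : Poly K X Y} (hf : f ∈ redSpan lt G S) :
    f = 0 ∨ ∃ p ∈ S, f ∈ redSpan lt G (insert p (pathsBelow lt p)) := by
  have mono : ∀ {p q : X ⟶ Y}, lt ⟨X, Y, p⟩ ⟨X, Y, q⟩ →
      insert p (pathsBelow lt p) ⊆ insert q (pathsBelow lt q) := by
    rintro p q hpq n (rfl | hn)
    · exact Or.inr hpq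
    · exact Or.inr (hlt.trans hn hpq)
  induction hf using Submodule.span_induction with
  | mem g hg =>
    obtain ⟨A, B, r, m, u, v, hr, hm, hS, rfl⟩ := hg
    exact Or.inr ⟨_, hS, whisker_mem_redSpan hr hm (Set.mem_insert _ _)⟩
  | zero => exact Or.inl rfl
  | add f g _ _ hf hg =>
    rcases hf with rfl | ⟨p, hp, hf⟩
    · simpa using hg
    rcases hg with rfl | ⟨q, hq, hg⟩
    · exact Or.inr ⟨p, hp, by simpa using hf⟩
    rcases hlt.trichotomous p q with h | rfl | h
    · exact Or.inr ⟨q, hq, add_mem (redSpan_mono (mono h) hf) hg⟩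
    · exact Or.inr ⟨p, hp, add_mem hf hg⟩
    · exact Or.inr ⟨p, hp, add_mem hf (redSpan_mono (mono h) hg)⟩
  | smul c f _ hf =>
    rcases hf with rfl | ⟨p, hp, hf⟩
    · exact Or.inl (smul_zero c)
    · exact Or.inr ⟨p, hp, Submodule.smul_mem _ _ hf⟩

/-- `p` is a multiple of the leading term of an element of `G`. -/
def IsReducible (lt : Quiver.Total (Paths V) → Quiver.Total (Paths V) → Prop)
    (G : Set (Arr K V)) (p : X ⟶ Y) : Prop :=
  ∃ (A B : Paths V) (r : Poly K A B) (m : A ⟶ B) (u : X ⟶ A) (v : B ⟶ Y),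
    r.toArr ∈ G ∧ IsLeadingTerm lt r m ∧ u ≫ m ≫ v = p

lemma IsReducible.exists_reduces {p : X ⟶ Y} (hp : IsReducible lt G p) {f : Poly K X Y}
    (hf : f.coeff p ≠ 0) : ∃ g, Reduces lt G f g := by
  obtain ⟨A, B, r, m, u, v, hr, hm, rfl⟩ := hp
  exact ⟨_, A, B, r, m, u, v, hr, hm, hf, rfl⟩

/-- Modulo the part below `p`, matches make all generators at `p` proportional to the single
multiple `e`. -/
lemma exists_smul_add_of_mem_redSpan (hlt : IsAdmissibleWellOrder lt) (hG : BuchbergerHalts lt G)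
    {p : X ⟶ Y} {e : Poly K X Y}
    (he : ∃ (A B : Paths V) (r : Poly K A B) (m : A ⟶ B) (u : X ⟶ A) (v : B ⟶ Y),
      r.toArr ∈ G ∧ IsLeadingTerm lt r m ∧ u ≫ m ≫ v = p ∧ e = Poly.whisker u v (r.monic m))
    {f : Poly K X Y} (hf : f ∈ redSpan lt G (insert p (pathsBelow lt p))) :
    ∃ (c : K), f - c • e ∈ redSpan lt G (pathsBelow lt p) := by
  obtain ⟨A, B, r, m, u, v, hr, hm, rfl, rfl⟩ := he
  induction hf using Submodule.span_induction with
  | mem g hg =>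
    obtain ⟨A', B', r', m', u', v', hr', hm', hS, rfl⟩ := hg
    rcases hS with hS | hS
    · refine ⟨r'.coeff m', ?_⟩
      have := Submodule.smul_mem _ (r'.coeff m') (match_mem_redSpan hlt hG hr' hr hm' hm hS)
      rw [hS, smul_sub, ← map_smul, Poly.monic, smul_smul, mul_inv_cancel₀ hm'.1,
        one_smul] at this
      exact this
    · refine ⟨0, ?_⟩
      rw [zero_smul, sub_zero]
      exact whisker_mem_redSpan hr' hm' hS
  | zero => exact ⟨0, by simp⟩
  | add f g _ _ hf hg =>
    obtain ⟨a, ha⟩ := hf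
    obtain ⟨b, hb⟩ := hg
    refine ⟨a + b, ?_⟩
    rw [add_smul, add_sub_add_comm]
    exact add_mem ha hb
  | smul c f _ hf =>
    obtain ⟨a, ha⟩ := hf
    refine ⟨c * a, ?_⟩
    rw [mul_smul, ← smul_sub]
    exact Submodule.smul_mem _ _ ha

lemma exists_isReducible_of_mem_redSpan_insert (hlt : IsAdmissibleWellOrder lt)
    (hG : BuchbergerHalts lt G) (p : X ⟶ Y) :
    ∀ f : Poly K X Y, f ∈ redSpan lt G (insert p (pathsBelow lt p)) → f ≠ 0 →
      ∃ q, f.coeff q ≠ 0 ∧ IsReducible lt G q := by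
  induction p using (hlt.wf X Y).induction with
  | _ p ih =>
  intro f hf hf0
  have below : f ∈ redSpan lt G (pathsBelow lt p) → ∃ q, f.coeff q ≠ 0 ∧ IsReducible lt G q := by
    intro h
    rcases exists_bound_of_mem_redSpan hlt h with rfl | ⟨q, hq, hfq⟩
    · exact absurd rfl hf0
    · exact ih q hq f hfq hf0
  by_cases hp : IsReducible lt G p
  · have hp' := hp
    obtain ⟨A, B, r, m, u, v, hr, hm, rfl⟩ := hp'
    obtain ⟨c, hc⟩ := exists_smul_add_of_mem_redSpan hlt hG
      ⟨A, B, r, m, u, v, hr, hm, rfl, rfl⟩ hf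
    by_cases hc0 : c = 0
    · exact below (by simpa [hc0] using hc)
    -- The remainder `f - c • e` lives below `p`, so the coefficient of `p` in `f` is `c`, which is
    -- nonzero.
    · refine ⟨_, fun h => ?_, hp⟩
      refine hlt.irrefl _ (lt_of_mem_redSpan_pathsBelow hlt hc (n := u ≫ m ≫ v) ?_)
      rw [Poly.coeff_sub, Poly.coeff_smul, Poly.coeff_whisker, hm.coeff_monic, h]
      simpa using hc0
  · refine below ((Submodule.span_le.2 ?_ : redSpan lt G _ ≤ _) hf)
    rintro _ ⟨A, B, r, m, u, v, hr, hm, hS, rfl⟩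
    rcases hS with hS | hS
    · exact absurd ⟨A, B, r, m, u, v, hr, hm, hS⟩ hp
    · exact whisker_mem_redSpan hr hm hS

lemma exists_isReducible_of_mem_redSpan (hlt : IsAdmissibleWellOrder lt)
    (hG : BuchbergerHalts lt G) {f : Poly K X Y} (hf : f ∈ redSpan lt G Set.univ) (hf0 : f ≠ 0) :
    ∃ q, f.coeff q ≠ 0 ∧ IsReducible lt G q := by
  rcases exists_bound_of_mem_redSpan hlt hf with rfl | ⟨p, -, hp⟩
  · exact absurd rfl hf0
  · exact exists_isReducible_of_mem_redSpan_insert hlt hG p f hp hf0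

lemma exists_normalForm (hlt : IsAdmissibleWellOrder lt) (f : Poly K X Y) :
    ∃ g, ReducesStar lt G f g ∧ ∀ h, ¬ Reduces lt G g h := by
  induction f using (wellFounded_reduces hlt G X Y).induction with
  | _ f ih =>
  by_cases hf : ∃ g, Reduces lt G f g
  · obtain ⟨g, hg⟩ := hf
    obtain ⟨k, hk, hk'⟩ := ih g hg
    exact ⟨k, hk.head hg, hk'⟩
  · exact ⟨f, .refl, fun h hh => hf ⟨h, hh⟩⟩

lemma exists_common_reduct (hlt : IsAdmissibleWellOrder lt) (hG : BuchbergerHalts lt G)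
    {f g : Poly K X Y} (h : f - g ∈ redSpan lt G Set.univ) :
    ∃ k, ReducesStar lt G f k ∧ ReducesStar lt G g k := by
  obtain ⟨f', hf, hf'⟩ := exists_normalForm (G := G) hlt f
  obtain ⟨g', hg, hg'⟩ := exists_normalForm (G := G) hlt g
  have hmem : f' - g' ∈ redSpan lt G Set.univ := by
    have := sub_mem (add_mem h (hg.sub_mem_redSpan hlt)) (hf.sub_mem_redSpan hlt)
    convert this using 1
    abel
  obtain rfl : f' = g' := by
    by_contra hne
    obtain ⟨q, hq, hred⟩ := exists_isReducible_of_mem_redSpan hlt hG hmem (sub_ne_zero.2 hne)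
    -- A path occurring in the difference occurs in one of the two normal forms, which would then be
    -- reducible.
    by_cases hfq : f'.coeff q = 0
    · obtain ⟨k, hk⟩ := hred.exists_reduces (f := g') fun h0 => hq (by simp [hfq, h0])
      exact hg' k hk
    · obtain ⟨k, hk⟩ := hred.exists_reduces hfq
      exact hf' k hk
  exact ⟨f', hf, hg⟩

lemma eqvGen_reduces_iff (hlt : IsAdmissibleWellOrder lt) (hG : BuchbergerHalts lt G)
    {f g : Poly K X Y} :
    Relation.EqvGen (Reduces lt G) f g ↔ f - g ∈ redSpan lt G Set.univ := by
  refine ⟨fun h => ?_, fun h => ?_⟩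
  · induction h with
    | rel f g h => exact ReducesStar.sub_mem_redSpan hlt (.single h)
    | refl f => simp
    | symm f g _ h => simpa using neg_mem h
    | trans f g h _ _ h₁ h₂ => simpa using add_mem h₁ h₂
  · obtain ⟨k, hf, hg⟩ := exists_common_reduct hlt hG h
    have toEqv : ∀ {a b : Poly K X Y}, ReducesStar lt G a b →
        Relation.EqvGen (Reduces lt G) a b := by
      intro a b hab
      induction hab with
      | refl => exact .refl _
      | tail _ h ih => exact .trans _ _ _ ih (.rel _ _ h)
    exact .trans _ _ _ (toEqv hf) (.symm _ _ (toEqv hg))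

end Confluence

/-! ### The ideal generated by `R` and its invariance under the algorithm -/

section Congruence

variable {K : Type w} [Field K] {V : Type u} [Quiver.{v} V]
  {lt : Quiver.Total (Paths V) → Quiver.Total (Paths V) → Prop} {R G : Set (Arr K V)}
  {X Y : Paths V}

/-- The ideal of the free `K`-category generated by `R`, at the objects `X` and `Y`. -/
noncomputable def ideal (R : Set (Arr K V)) (X Y : Paths V) : Submodule K (Poly K X Y) :=
  Submodule.span K
    {g : Poly K X Y | ∃ (A B : Paths V) (p : Poly K X A) (r : Poly K A B) (q : Poly K B Y),
      r.toArr ∈ R ∧ g = p ≫ r ≫ q}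

lemma mem_ideal {r : Poly K X Y} (hr : r.toArr ∈ R) : r ∈ ideal R X Y :=
  Submodule.subset_span ⟨X, Y, 𝟙 _, r, 𝟙 _, hr, by simp⟩

lemma comp_mem_ideal {W Z : Paths V} (p : Poly K W X) (q : Poly K Y Z) {f : Poly K X Y}
    (hf : f ∈ ideal R X Y) : p ≫ f ≫ q ∈ ideal R W Z := by
  have : ideal R X Y ≤
      (ideal R W Z).comap (Linear.leftComp K _ p ∘ₗ Linear.rightComp K _ q) := by
    refine Submodule.span_le.2 ?_
    rintro _ ⟨A, B, p', r, q', hr, rfl⟩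
    exact Submodule.subset_span ⟨A, B, p ≫ p', r, q' ≫ q, hr, by simp⟩
  exact this hf

lemma ideal_le (h : ∀ {A B : Paths V} (r : Poly K A B), r.toArr ∈ R → r ∈ ideal G A B)
    (X Y : Paths V) : ideal R X Y ≤ ideal G X Y := by
  refine Submodule.span_le.2 ?_
  rintro _ ⟨A, B, p, r, q, hr, rfl⟩
  exact comp_mem_ideal p q (h r hr)

lemma redSpan_univ (hlt : IsAdmissibleWellOrder lt) (R : Set (Arr K V)) (X Y : Paths V) :
    redSpan lt R Set.univ = ideal R X Y := by
  refine le_antisymm (Submodule.span_le.2 ?_) (Submodule.span_le.2 ?_)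
  · rintro _ ⟨A, B, r, m, u, v, hr, -, -, rfl⟩
    exact comp_mem_ideal _ _ (mem_ideal hr)
  · rintro _ ⟨A, B, p, r, q, hr, rfl⟩
    rw [SetLike.mem_coe]
    -- A zero generator has no leading term and gives no element of the spanning set, but it
    -- contributes only zero to the ideal.
    by_cases hr0 : r = 0
    · simp [hr0]
    obtain ⟨m, hm⟩ := exists_isLeadingTerm hlt hr0
    have : Submodule.span K (Poly.ofPath K '' {n | p.coeff n ≠ 0}) ≤
        (redSpan lt R Set.univ).comap (Linear.rightComp K _ (r ≫ q)) := by
      refine Submodule.span_le.2 ?_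
      rintro _ ⟨n, -, rfl⟩
      have := whisker_mem_redSpan_of_mem (u := n) (v := 𝟙 Y) (fun _ _ => Set.mem_univ _)
        (comp_right_mem_redSpan hr hm (q := q) (S := Set.univ) fun _ _ => trivial)
      simpa [Poly.whisker_apply, Poly.ofPath_id] using this
    exact this p.mem_span_ofPath

lemma IsSPoly.mem_ideal {s : Poly K X Y} (hs : IsSPoly lt R s) : s ∈ ideal R X Y := by
  have hmonic : ∀ {A B : Paths V} (r : Poly K A B) (m : A ⟶ B), r.toArr ∈ R →
      r.monic m ∈ ideal R A B := fun r m hr =>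
    Submodule.smul_mem _ _ (KCat.mem_ideal hr)
  induction hs with
  | inside r₁ r₂ m₁ m₂ u v h₁ h₂ =>
    exact sub_mem (comp_mem_ideal _ _ (hmonic _ _ h₁)) (hmonic _ _ h₂)
  | contains r₁ r₂ m₁ m₂ u v h₁ h₂ =>
    exact sub_mem (hmonic _ _ h₁) (comp_mem_ideal _ _ (hmonic _ _ h₂))
  | right r₁ r₂ u w v h₁ h₂ =>
    refine sub_mem ?_ ?_
    · simpa using comp_mem_ideal (Poly.ofPath K u) (𝟙 _) (hmonic r₁ (w ≫ v) h₁)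
    · simpa using comp_mem_ideal (𝟙 _) (Poly.ofPath K v) (hmonic r₂ (u ≫ w) h₂)
  | left r₁ r₂ u w v h₁ h₂ =>
    refine sub_mem ?_ ?_
    · simpa using comp_mem_ideal (𝟙 _) (Poly.ofPath K v) (hmonic r₁ (u ≫ w) h₁)
    · simpa using comp_mem_ideal (Poly.ofPath K u) (𝟙 _) (hmonic r₂ (w ≫ v) h₂)

lemma toArr_injective : Function.Injective (Poly.toArr : Poly K X Y → Arr K V) := by
  intro f g h
  simpa [Poly.toArr] using h

lemma IsNewPoly.mem_ideal (hlt : IsAdmissibleWellOrder lt) {f : Poly K X Y}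
    (hf : IsNewPoly lt R f.toArr) : f ∈ ideal R X Y := by
  obtain ⟨X', Y', s, t, c, hs, hst, -, -, h⟩ := hf
  obtain rfl : X = X' := congrArg Quiver.Total.left h
  obtain rfl : Y = Y' := congrArg Quiver.Total.right h
  obtain rfl := toArr_injective h
  have := hst.sub_mem_redSpan hlt
  rw [redSpan_univ hlt] at this
  refine Submodule.smul_mem _ _ ?_
  simpa using sub_mem hs.mem_ideal this

lemma BuchbergerStep.ideal_eq (hlt : IsAdmissibleWellOrder lt) (h : BuchbergerStep lt R G)
    (X Y : Paths V) : ideal G X Y = ideal R X Y := by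
  obtain ⟨T, -, hT, rfl⟩ := h
  refine le_antisymm (ideal_le (fun r hr => ?_) X Y)
    (ideal_le (fun r hr => mem_ideal (Or.inl hr)) X Y)
  rcases hr with hr | hr
  · exact mem_ideal hr
  · exact (hT _ hr).mem_ideal hlt

lemma ideal_eq_of_reflTransGen (hlt : IsAdmissibleWellOrder lt)
    (h : Relation.ReflTransGen (BuchbergerStep lt) R G) (X Y : Paths V) :
    ideal G X Y = ideal R X Y := by
  induction h with
  | refl => rfl
  | tail _ h ih => exact (h.ideal_eq hlt X Y).trans ih

end Congruence

end KCat

theorem theorem3p5 {K : Type*} [Field K] {V : Type*} [Quiver V]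
    (lt : Quiver.Total (Paths V) → Quiver.Total (Paths V) → Prop)
    (hlt : KCat.IsAdmissibleWellOrder lt)
    (R G : Set (KCat.Arr K V))
    (hG : KCat.BuchbergerReturns lt R G) :
    KCat.IsGroebnerBasisFor lt G R := by
  obtain ⟨hrun, hhalt⟩ := hG
  refine ⟨⟨KCat.wellFounded_reduces hlt G, fun X Y f g h hg hh => ?_⟩, fun X Y f h => ?_⟩
  · refine KCat.exists_common_reduct hlt hhalt ?_
    simpa using sub_mem (hh.sub_mem_redSpan hlt) (hg.sub_mem_redSpan hlt)
  · rw [KCat.eqvGen_reduces_iff hlt hhalt, KCat.redSpan_univ hlt,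
      KCat.ideal_eq_of_reflTransGen hlt hrun]
    -- `Cong` is by definition membership of the difference in `ideal R X Y`.
    rfl
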